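/- Let $\mathcal M$ be a finite-dimensional Hadamard manifold (a complete, simply connected smooth Riemannian manifold of nonpositive sectional curvature) with Riemannian distance $d$, and let $f=g_1+g_2-h$, where $g_1:\mathcal M\to\mathbb R\cup\{+\infty\}$ is proper and lower semicontinuous, for every $y\in\mathcal M$ there is $\gamma\in\mathbb R$ with $\liminf_{d(x,y)\to+\infty} g_1(x)/d(x,y)>\gamma$, $g_2:\mathcal M\to\mathbb R$ is continuously differentiable with $L$-Lipschitz gradient for some $L>0$ (unknown to the method), and $h:\mathcal M\to\mathbb R$ is (geodesically) convex. Assume $f(x)\ge f^{\rm low}$ for all $x\in\mathcal M$, where $f^{\rm low}\in\mathbb R$. Given $x^0$ with $f(x^0)<+\infty$, $\lambda_0>0$ and $\epsilon>0$, the method Adap-RPPM performs, for $k=0,1,2,\dots$, the following iteration. Choose $w^k\in\partial h(x^k)=\{u\in T_{x^k}\mathcal M:\langle u,\exp_{x^k}^{-1}y\rangle\le h(y)-h(x^k)\ \forall y\in\mathcal M\}$ and put $v^k=\operatorname{grad} g_2(x^k)$. Then: (i) put $z^k=\exp_{x^k}\big(\tfrac1{\lambda_k}(w^k-v^k)\big)$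 and take for $x^{k+1}$ any global minimizer over $\mathcal M$ of $x\mapsto g_1(x)+\tfrac{\lambda_k}{2}d^2(x,z^k)$; (ii) if $d(x^{k+1},x^k)\le\epsilon$, stop and return $x^{k+1}$; (iii) otherwise, if $f(x^{k+1})-f(x^k)\le-\tfrac{\lambda_k}{4}d^2(x^{k+1},x^k)$, accept $x^{k+1}$, put $\lambda_{k+1}=\lambda_k$ and pass to iteration $k+1$; if this inequality fails, replace $\lambda_k$ by $2\lambda_k$ and return to (i) with the same $w^k$. Below, $\lambda_0$ denotes the input value, and an iteration $k$ is complete once $x^{k+1}$ has been accepted or returned. Suppose that iterations $k=0,\dots,T$ are completed, with iterates $x^0,\dots,x^{T+1}$, and that $d(x^{k+1},x^k)>\epsilon$ for $k=0,\dots,T$. Then $$T<\frac{4\,(f(x^0)-f^{\rm low})}{\lambda_0\,\epsilon^2}.$$ Moreover, whenever the method completes iterations $k=0,\dots,T$ (it may stop at iteration $T$, but not before), one has $T\le \frac{4(f(x^0)-f^{\rm low})}{\lambda_0}\,\epsilon^{-2}$. Thus the iteration complexity is $O(\epsilon^{-2})$, with a constant that does not depend on $L$. -/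

import Mathlib

open scoped Manifold ContDiff Topology Bundle

noncomputable section

/-! ### Riemannian geometry in charts

`M` is a smooth manifold modelled on `ℝⁿ`; its tangent spaces carry the inner products given by the
`RiemannianBundle` instance, and its distance is the Riemannian one (`IsRiemannianManifold`). -/

section Geometry

variable {n : ℕ} {M : Type*} [MetricSpace M] [ChartedSpace (EuclideanSpace ℝ (Fin n)) M]

/-- The `i`-th coordinate vector field `∂ᵢ` of the chart at `c`, as a tangent vector at the point
with coordinates `y`. -/
def chartBasis (c : M) (y : EuclideanSpace ℝ (Fin n)) (i : Fin n) :
    TangentSpace (𝓡 n) ((chartAt (EuclideanSpace ℝ (Fin n)) c).symm y) :=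
  mfderiv (𝓡 n) (𝓡 n) (chartAt (EuclideanSpace ℝ (Fin n)) c).symm y
    (EuclideanSpace.single i (1 : ℝ))

/-- The partial derivative `∂ᵢ F` of a function of `n` real variables. -/
def partialDeriv (i : Fin n) (F : EuclideanSpace ℝ (Fin n) → ℝ) (y : EuclideanSpace ℝ (Fin n)) :
    ℝ :=
  fderiv ℝ F y (EuclideanSpace.single i (1 : ℝ))

variable [Bundle.RiemannianBundle (fun x : M => TangentSpace (𝓡 n) x)]

/-- The matrix `g_{ij} = ⟨∂ᵢ, ∂ⱼ⟩` of the metric in the chart at `c`, at the coordinates `y`. -/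
def metricMatrix (c : M) (y : EuclideanSpace ℝ (Fin n)) : Matrix (Fin n) (Fin n) ℝ :=
  Matrix.of fun i j => inner ℝ (chartBasis c y i) (chartBasis c y j)

/-- The Christoffel symbol
`Γᵏ_{ij} = ½ ∑ₗ gᵏˡ (∂ᵢ g_{jl} + ∂ⱼ g_{il} - ∂ₗ g_{ij})` of the Levi-Civita connection. -/
def christoffel (c : M) (k i j : Fin n) (y : EuclideanSpace ℝ (Fin n)) : ℝ :=
  (1 / 2 : ℝ) * ∑ l, (metricMatrix c y)⁻¹ k l *
    (partialDeriv i (fun z => metricMatrix c z j l) y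
      + partialDeriv j (fun z => metricMatrix c z i l) y
      - partialDeriv l (fun z => metricMatrix c z i j) y)

/-- The component `Rˡ_{ijk}` of the curvature tensor, `R(∂ᵢ, ∂ⱼ) ∂ₖ = ∑ₗ Rˡ_{ijk} ∂ₗ`, where
`R(X, Y) Z = ∇_X ∇_Y Z - ∇_Y ∇_X Z - ∇_{[X, Y]} Z`. -/
def curvatureCoeff (c : M) (l i j k : Fin n) (y : EuclideanSpace ℝ (Fin n)) : ℝ :=
  partialDeriv i (christoffel c l j k) y - partialDeriv j (christoffel c l i k) y
    + ∑ m, (christoffel c m j k y * christoffel c l i m y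
      - christoffel c m i k y * christoffel c l j m y)

variable (n M) in
/-- Nonpositive sectional curvature: `⟨R(u, v) v, u⟩ ≤ 0` for all tangent vectors `u`, `v`
(the sectional curvature of a plane is this number divided by the squared area of the
parallelogram spanned by `u` and `v`). -/
def NonposSectionalCurvature : Prop :=
  ∀ (c : M), ∀ y ∈ (chartAt (EuclideanSpace ℝ (Fin n)) c).target, ∀ u v : Fin n → ℝ,
    ∑ i, ∑ j, ∑ k, ∑ l, ∑ p,
      metricMatrix c y l p * curvatureCoeff c l i j k y * u i * v j * v k * u p ≤ 0

variable (n M) in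
/-- A Hadamard manifold: complete, simply connected, of nonpositive sectional curvature. -/
structure IsHadamardManifold : Prop where
  complete : CompleteSpace M
  simplyConnected : SimplyConnectedSpace M
  nonpos : NonposSectionalCurvature n M

/-- The velocity `γ'(t)`. -/
def velocity (γ : ℝ → M) (t : ℝ) : TangentSpace (𝓡 n) (γ t) :=
  mfderiv 𝓘(ℝ, ℝ) (𝓡 n) γ t (1 : ℝ)

/-- The components, in the chart at `c`, of a tangent vector `v` at `x`. -/
def chartComponents (c x : M) (v : TangentSpace (𝓡 n) x) : EuclideanSpace ℝ (Fin n) :=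
  mfderiv (𝓡 n) (𝓡 n) (chartAt (EuclideanSpace ℝ (Fin n)) c) x v

/-- The vector field `V` along the curve `γ` is parallel, `∇_{γ'} V = 0`. In every chart this is
`(Vᵏ)' + ∑_{i,j} Γᵏ_{ij}(γ) (γ')ⁱ Vʲ = 0`. -/
def IsParallelAlong (γ : ℝ → M) (V : ∀ t : ℝ, TangentSpace (𝓡 n) (γ t)) : Prop :=
  ∀ (c : M) (t : ℝ), γ t ∈ (chartAt (EuclideanSpace ℝ (Fin n)) c).source → ∀ k : Fin n,
    HasDerivAt (fun s => chartComponents c (γ s) (V s) k)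
      (-∑ i, ∑ j, christoffel c k i j (chartAt (EuclideanSpace ℝ (Fin n)) c (γ t))
        * chartComponents c (γ t) (velocity γ t) i * chartComponents c (γ t) (V t) j) t

variable (n) in
/-- `γ : ℝ → M` is a geodesic: a smooth curve whose velocity field is parallel. -/
def IsGeodesic (γ : ℝ → M) : Prop :=
  ContMDiff 𝓘(ℝ, ℝ) (𝓡 n) ∞ γ ∧ IsParallelAlong γ (fun t => velocity (n := n) γ t)

open Classical in
/-- The exponential map: `exp_x(v) = γ(1)` for the geodesic `γ` with `γ(0) = x`, `γ'(0) = v`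
(such a `γ` exists and is unique on a complete manifold; the value is `x` if there is none). -/
def expMap (x : M) (v : TangentSpace (𝓡 n) x) : M :=
  if H : ∃ γ : ℝ → M, IsGeodesic n γ ∧
      (⟨γ 0, velocity γ 0⟩ : TangentBundle (𝓡 n) M) = ⟨x, v⟩
  then H.choose 1 else x

/-- The inverse `exp_x⁻¹ : M → T_x M` of the exponential map (a bijection on a Hadamard
manifold). -/
def expInv (x y : M) : TangentSpace (𝓡 n) x :=
  Function.invFun (expMap (n := n) x) y

variable (n) in
/-- Convexity on `M`: convexity along all geodesics. -/
def GeodesicallyConvex (h : M → ℝ) : Prop :=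
  ∀ γ : ℝ → M, IsGeodesic n γ → ConvexOn ℝ Set.univ (h ∘ γ)

/-- The subdifferential of a convex function. -/
def convexSubdifferential (h : M → ℝ) (x : M) : Set (TangentSpace (𝓡 n) x) :=
  {u | ∀ y : M, inner ℝ u (expInv x y) ≤ h y - h x}

instance tangentFiniteDimensional (x : M) : FiniteDimensional ℝ (TangentSpace (𝓡 n) x) :=
  inferInstanceAs (FiniteDimensional ℝ (EuclideanSpace ℝ (Fin n)))

instance tangentComplete (x : M) : CompleteSpace (TangentSpace (𝓡 n) x) :=
  FiniteDimensional.complete ℝ (TangentSpace (𝓡 n) x)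

/-- The Riemannian gradient: `⟨grad g(x), v⟩ = dg_x(v)` for all `v`. -/
def riemGrad (g : M → ℝ) (x : M) : TangentSpace (𝓡 n) x :=
  (InnerProductSpace.toDual ℝ (TangentSpace (𝓡 n) x)).symm (mfderiv (𝓡 n) 𝓘(ℝ, ℝ) g x)

variable (n) in
/-- The gradient of `g` is `L`-Lipschitz: `‖grad g(y) - P grad g(x)‖ ≤ L d(x, y)`, where
`P : T_x M → T_y M` is the parallel transport along a geodesic from `x = γ(0)` to `y = γ(1)`;
below, `P grad g(x) = V(1)` for the parallel field `V` along `γ` with `V(0) = grad g(x)`. -/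
def LipschitzGradient (L : ℝ) (g : M → ℝ) : Prop :=
  ∀ (γ : ℝ → M) (V : ∀ t : ℝ, TangentSpace (𝓡 n) (γ t)), IsGeodesic n γ → IsParallelAlong γ V →
    V 0 = riemGrad g (γ 0) → ‖riemGrad g (γ 1) - V 1‖ ≤ L * dist (γ 0) (γ 1)

/-! ### The optimization problem -/

/-- The objective `f = g₁ + g₂ - h`, with values in `ℝ ∪ {+∞}` when `g₁` never takes the
value `-∞`. -/
def objective (g₁ : M → EReal) (g₂ h : M → ℝ) (x : M) : EReal :=
  g₁ x + ((g₂ x - h x : ℝ) : EReal)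

variable (n) in
/-- The standing assumptions on `f = g₁ + g₂ - h`: `g₁ : M → ℝ ∪ {+∞}` is proper, lower
semicontinuous and `liminf g₁(x) / d(x, y) > -∞` as `d(x, y) → ∞`, `g₂` is `C¹` with Lipschitz
gradient, `h` is convex, and `f` is bounded below by `fLow`. -/
structure IsNonconvexProblem (g₁ : M → EReal) (g₂ h : M → ℝ) (fLow : ℝ) : Prop where
  ne_bot : ∀ x, g₁ x ≠ ⊥
  proper : ∃ x, g₁ x ≠ ⊤
  lsc : LowerSemicontinuous g₁
  growth : ∀ y : M, ∃ γ : ℝ, (γ : EReal) <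
    Filter.liminf (fun x => g₁ x / ((dist x y : ℝ) : EReal))
      (Filter.comap (fun x => dist x y) Filter.atTop)
  smooth : ContMDiff (𝓡 n) 𝓘(ℝ, ℝ) 1 g₂
  lipschitz : ∃ L : ℝ, 0 < L ∧ LipschitzGradient n L g₂
  convex : GeodesicallyConvex n h
  bounded : ∀ x, (fLow : EReal) ≤ objective g₁ g₂ h x

/-! ### The adaptive Riemannian proximal point method -/

/-- `y` minimizes `x ↦ g₁(x) + (lam / 2) d(x, z)²` over `M`. -/
def IsProxPoint (g₁ : M → EReal) (lam : ℝ) (z y : M) : Prop :=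
  ∀ x : M, g₁ y + ((lam / 2 * dist y z ^ 2 : ℝ) : EReal)
    ≤ g₁ x + ((lam / 2 * dist x z ^ 2 : ℝ) : EReal)

/-- `y` is a possible outcome of the proximal subproblem at the current point `x`, with chosen
subgradient `w` and parameter `lam`: its center is `z = exp_x((1 / lam) (w - grad g₂(x)))`. -/
def IsTrialPoint (g₁ : M → EReal) (g₂ : M → ℝ) (x : M) (w : TangentSpace (𝓡 n) x)
    (lam : ℝ) (y : M) : Prop :=
  IsProxPoint g₁ lam (expMap x ((1 / lam) • (w - riemGrad g₂ x))) y

/-- The sufficient-decrease test `f(y) - f(x) ≤ -(lam / 4) d(y, x)²`. -/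
def SufficientDecrease (g₁ : M → EReal) (g₂ h : M → ℝ) (x : M) (lam : ℝ) (y : M) : Prop :=
  objective g₁ g₂ h y - objective g₁ g₂ h x ≤ ((-(lam / 4) * dist y x ^ 2 : ℝ) : EReal)

/-- The inner loop at the current point `x` with subgradient `w`. `InnerLoop … lam y lam'` says
that, entered with parameter `lam`, it may end with the next iterate `y` and parameter `lam'`.
A trial point within `ε` of `x` stops the method; otherwise the trial point is accepted if it passes
the test, and if it does not, the parameter is doubled and a new trial point is computed. -/
inductive InnerLoop (g₁ : M → EReal) (g₂ h : M → ℝ) (ε : ℝ) (x : M)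
    (w : TangentSpace (𝓡 n) x) : ℝ → M → ℝ → Prop
  | halt {lam : ℝ} {y : M} : IsTrialPoint g₁ g₂ x w lam y → dist y x ≤ ε →
      InnerLoop g₁ g₂ h ε x w lam y lam
  | accept {lam : ℝ} {y : M} : IsTrialPoint g₁ g₂ x w lam y → ε < dist y x →
      SufficientDecrease g₁ g₂ h x lam y → InnerLoop g₁ g₂ h ε x w lam y lam
  | double {lam lam' : ℝ} {y y' : M} : IsTrialPoint g₁ g₂ x w lam y' → ε < dist y' x →
      ¬ SufficientDecrease g₁ g₂ h x lam y' → InnerLoop g₁ g₂ h ε x w (2 * lam) y lam' →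
      InnerLoop g₁ g₂ h ε x w lam y lam'

variable (n) in
/-- `x 0, …, x (T + 1)` are generated by the iterations `k = 0, …, T` of the method with input
`x₀`, `lam₀`, `ε`: each iteration chooses a subgradient `w ∈ ∂h(x k)` and runs the inner loop from
the current parameter `lam k`, and the method did not stop before iteration `T`. -/
def IsAdapRPPMRun (g₁ : M → EReal) (g₂ h : M → ℝ) (x₀ : M) (lam₀ ε : ℝ) (T : ℕ)
    (x : ℕ → M) : Prop :=
  x 0 = x₀ ∧ ∃ lam : ℕ → ℝ, lam 0 = lam₀ ∧
    (∀ k ≤ T, ∃ w ∈ convexSubdifferential (n := n) h (x k),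
      InnerLoop g₁ g₂ h ε (x k) w (lam k) (x (k + 1)) (lam (k + 1))) ∧
    ∀ k < T, ε < dist (x (k + 1)) (x k)

end Geometry

end

/-!
The bound is a telescoping argument. An iteration that does not stop leaves its inner loop through
the sufficient-decrease test, and the parameter is only ever doubled, so it stays at least `lam₀`.
Hence every such iteration lowers the objective by at least `lam₀ / 4 * ε ^ 2`
(`InnerLoop.le_and_sufficientDecrease`, `SufficientDecrease.exists_real`). Summing over the first
`N` iterations and comparing with the lower bound `fLow` gives
`N * (lam₀ / 4 * ε ^ 2) ≤ f(x₀) - fLow` (`IsAdapRPPMRun.mul_le_sub`). For the strict bound all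
`T + 1` iterations count; for the weak one the last iteration may be the stopping one, and the
first `T` count.

The constant is independent of `L` because the decrease per iteration is certified by the acceptance
test itself. The Lipschitz gradient and the geometry of `M` decide how long an inner loop runs, not
how much a completed one gains.
-/

section DescentBound

variable {n : ℕ} {M : Type*} [MetricSpace M] [ChartedSpace (EuclideanSpace ℝ (Fin n)) M]
  [Bundle.RiemannianBundle (fun x : M => TangentSpace (𝓡 n) x)]
  {g₁ : M → EReal} {g₂ h : M → ℝ}

/-- An inner loop that ends farther than `ε` from `x` has not decreased the parameter, and its
outcome passes the sufficient-decrease test with the final parameter. -/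
lemma InnerLoop.le_and_sufficientDecrease {ε : ℝ} {x : M} {w : TangentSpace (𝓡 n) x}
    {lam lam' : ℝ} {y : M} (H : InnerLoop g₁ g₂ h ε x w lam y lam') (hlam : 0 < lam)
    (hy : ε < dist y x) : lam ≤ lam' ∧ SufficientDecrease g₁ g₂ h x lam' y := by
  induction H with
  | halt _ hle => exact absurd hle hy.not_ge
  | accept _ _ hdec => exact ⟨le_rfl, hdec⟩
  | double _ _ _ _ ih =>
    obtain ⟨hle, hdec⟩ := ih (by linarith) hy
    exact ⟨by linarith, hdec⟩

/-- The sufficient-decrease test in real numbers. It cannot be passed by a point where the objective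
is `+∞`, so finiteness of the objective propagates along the iterates. -/
lemma SufficientDecrease.exists_real {x y : M} {lam a : ℝ}
    (H : SufficientDecrease g₁ g₂ h x lam y) (hx : objective g₁ g₂ h x = (a : EReal))
    (hy : objective g₁ g₂ h y ≠ ⊥) :
    ∃ b : ℝ, objective g₁ g₂ h y = (b : EReal) ∧ b ≤ a - lam / 4 * dist y x ^ 2 := by
  unfold SufficientDecrease at H
  rw [hx] at H
  generalize objective g₁ g₂ h y = F at H hy
  induction F with
  | bot => exact absurd rfl hy
  | top =>
    rw [EReal.top_sub_coe] at H
    exact absurd (top_le_iff.mp H) (EReal.coe_ne_top _)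
  | coe b =>
    refine ⟨b, rfl, ?_⟩
    rw [← EReal.coe_sub, EReal.coe_le_coe_iff] at H
    linarith

/-- If the first `N` iterations of a run all move by more than `ε`, then they lower the objective by
`N * (lam₀ / 4 * ε ^ 2)` in total, which is at most the gap `f(x₀) - fLow`. -/
lemma IsAdapRPPMRun.mul_le_sub {x₀ : M} {lam₀ ε fLow : ℝ} {T N : ℕ} {x : ℕ → M}
    (H : IsAdapRPPMRun n g₁ g₂ h x₀ lam₀ ε T x) (hx₀ : objective g₁ g₂ h x₀ ≠ ⊤)
    (hlow : ∀ y, (fLow : EReal) ≤ objective g₁ g₂ h y) (hlam₀ : 0 < lam₀) (hε : 0 < ε)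
    (hN : N ≤ T + 1) (hmove : ∀ k < N, ε < dist (x (k + 1)) (x k)) :
    N * (lam₀ / 4 * ε ^ 2) ≤ (objective g₁ g₂ h x₀).toReal - fLow := by
  have hbot : ∀ y, objective g₁ g₂ h y ≠ ⊥ := fun y =>
    ((EReal.bot_lt_coe fLow).trans_le (hlow y)).ne'
  obtain ⟨hx, lam, hlam, hloop, -⟩ := H
  have key : ∀ k ≤ N, lam₀ ≤ lam k ∧ ∃ a : ℝ, objective g₁ g₂ h (x k) = (a : EReal) ∧
      a ≤ (objective g₁ g₂ h x₀).toReal - k * (lam₀ / 4 * ε ^ 2) := by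
    intro k
    induction k with
    | zero =>
      intro _
      refine ⟨hlam.ge, (objective g₁ g₂ h x₀).toReal, ?_, by simp⟩
      rw [hx, EReal.coe_toReal hx₀ (hbot x₀)]
    | succ k ih =>
      intro hk
      obtain ⟨hle, a, ha, hadec⟩ := ih (by omega)
      obtain ⟨w, -, hw⟩ := hloop k (by omega)
      have hd := hmove k (by omega)
      obtain ⟨hle', hdec⟩ := hw.le_and_sufficientDecrease (hlam₀.trans_le hle) hd
      obtain ⟨b, hb, hbdec⟩ := hdec.exists_real ha (hbot _)
      refine ⟨hle.trans hle', b, hb, ?_⟩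
      have hstep : lam₀ / 4 * ε ^ 2 ≤ lam (k + 1) / 4 * dist (x (k + 1)) (x k) ^ 2 := by
        have hle₀ := hle.trans hle'
        have hnonneg : 0 ≤ lam (k + 1) / 4 := by linarith
        gcongr
      push_cast
      linarith
  obtain ⟨-, a, ha, hadec⟩ := key N le_rfl
  have hfa : fLow ≤ a := by
    have := hlow (x N)
    rwa [ha, EReal.coe_le_coe_iff] at this
  linarith

end DescentBound

theorem theorem4p1 {n : ℕ} {M : Type*} [MetricSpace M]
    [ChartedSpace (EuclideanSpace ℝ (Fin n)) M] [IsManifold (𝓡 n) ∞ M]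
    [Bundle.RiemannianBundle (fun x : M => TangentSpace (𝓡 n) x)]
    [IsContMDiffRiemannianBundle (𝓡 n) ∞ (EuclideanSpace ℝ (Fin n))
      (fun x : M => TangentSpace (𝓡 n) x)]
    [IsRiemannianManifold (𝓡 n) M] (hM : IsHadamardManifold n M)
    (g₁ : M → EReal) (g₂ h : M → ℝ) (fLow : ℝ) (hP : IsNonconvexProblem n g₁ g₂ h fLow)
    (x₀ : M) (hx₀ : objective g₁ g₂ h x₀ ≠ ⊤) (lam₀ : ℝ) (hlam₀ : 0 < lam₀) :
    (∀ ε : ℝ, 0 < ε → ∀ (T : ℕ) (x : ℕ → M), IsAdapRPPMRun n g₁ g₂ h x₀ lam₀ ε T x →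
      (∀ k ≤ T, ε < dist (x (k + 1)) (x k)) →
      (T : ℝ) < 4 * ((objective g₁ g₂ h x₀).toReal - fLow) / (lam₀ * ε ^ 2)) ∧
    (∀ ε : ℝ, 0 < ε → ∀ (T : ℕ) (x : ℕ → M), IsAdapRPPMRun n g₁ g₂ h x₀ lam₀ ε T x →
      (T : ℝ) ≤ 4 * ((objective g₁ g₂ h x₀).toReal - fLow) / lam₀ * ε ^ (-2 : ℤ)) := by
  refine ⟨fun ε hε T x H hmove => ?_, fun ε hε T x H => ?_⟩
  · have hN := H.mul_le_sub hx₀ hP.bounded hlam₀ hε le_rfl fun k hk =>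
      hmove k (Nat.lt_succ_iff.mp hk)
    have hpos : 0 < lam₀ * ε ^ 2 := by positivity
    rw [lt_div_iff₀ hpos]
    push_cast at hN
    linarith
  · have hN := H.mul_le_sub hx₀ hP.bounded hlam₀ hε T.le_succ H.2.choose_spec.2.2
    rw [zpow_neg, ← div_eq_mul_inv, div_div, le_div_iff₀ (mul_pos hlam₀ (zpow_pos hε 2))]
    rw [show ε ^ (2 : ℤ) = ε ^ 2 from zpow_ofNat ε 2]
    linarith
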